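/- **Definitions.** Let $d$ be a distance on a set $A$. Write $B_r(x)=\{y: d(x,y)<r\}$ and $(y,z)_x=\tfrac12\big(d(x,y)+d(x,z)-d(y,z)\big)$. * $(A,d)$ is *$\delta$-hyperbolic* if $(x,z)_w\ge \min\big((x,y)_w,(y,z)_w\big)-\delta$ for all $x,y,z,w\in A$. * A measure $\mu$ on $(A,d)$ has *$(a,b)$-pinched exponential growth* if there are constants $c,C>0$ such that $c\,a^r\le\mu(B_r(x))\le C\,b^r$ for all $x\in A$ and all real $r\ge 1$. * $\mu$ is *locally doubling* if all balls of positive radius have positive finite measure and for each $s>0$ there is a finite constant $L_s$ such that $\mu(B_{2r}(x))\le L_s\,\mu(B_r(x))$ for all $x\in A$ and $0<r\le s$. * For $\delta\ge 0$ and $1<a\le b$, the class $\mathcal X_{a,b}^{\delta}$ consists of all $(X,d,\mu)$, where $(X,d)$ is a connected, noncompact, complete, $\delta$-hyperbolic metric space with strictly intrinsic metric (any two points are joined by a continuous path whose length equals their distance) and $\mu$ is a locally doubling Borel measure on $X$ with $(a,b)$-pinched exponential growth. * Let $\mathrm T$ be a tree with root $o$. The *level* of a vertex $x$ is its tree distance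 from $o$, and the *predecessor* of $x\ne o$ is its unique neighbour in $\mathrm T$ whose level is one less than that of $x$. A *spider's web* $\widehat\Gamma$ associated to $\mathrm T$ is a simple graph, in which every vertex has finitely many neighbours, obtained from $\mathrm T$ by adding a (possibly empty) set of edges on the same vertices, such that (i) every added edge joins two vertices of the same level; (ii) if two vertices of the same level are adjacent in $\widehat\Gamma$, then their predecessors coincide or are adjacent in $\widehat\Gamma$. It is endowed with its graph distance $d_{\widehat\Gamma}$ and the counting measure $\mu_{\widehat\Gamma}$ on its vertices. * For $\beta\ge0$, a map $\varphi:(A,d)\to(A',d')$ is a *strict $\beta$-rough isometry* if $d(x,y)-\beta\le d'(\varphi(x),\varphi(y))\le d(x,y)+\beta$ for all $x,y\in A$, and every point of $A'$ lies within a bounded distance, uniformly, of $\varphi(A)$. **Theorem.** Let $\delta\ge0$ and $1<a\le b$, and let $(X,d,\mu)$ belong to $\mathcal X_{a,b}^{\delta}$. Then there exist $\delta'>0$, a closed discrete subset $V$ of $X$, a rooted tree $\mathrm T$ with vertex set $V$, and a spider's web $\widehat\Gamma$ associated to $\mathrm T$ such that 1. $(\widehat\Gamma,d_{\widehat\Gamma})$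 is $\delta'$-hyperbolic; 2. the counting measure $\mu_{\widehat\Gamma}$ has $(a,b)$-pinched exponential growth with respect to $d_{\widehat\Gamma}$; 3. for some $\beta\ge 0$ the inclusion $V\hookrightarrow X$ is a strict $\beta$-rough isometry from $(\widehat\Gamma,d_{\widehat\Gamma})$ to $(X,d)$; in particular $\widehat\Gamma$ is strictly roughly isometric to $X$. -/

import Mathlib

open MeasureTheory
open scoped ENNReal NNReal

namespace SpidersWeb

/-- The Gromov product `(y, z)_x` with respect to the distance function `d`. Distances are passed
explicitly since the same set will carry both a metric and a graph distance. -/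
noncomputable def gromovProduct {A : Type*} (d : A → A → ℝ) (y z x : A) : ℝ :=
  (1 / 2) * (d x y + d x z - d y z)

/-- Gromov hyperbolicity with constant `δ`: the four points condition. -/
def IsHyperbolic {A : Type*} (d : A → A → ℝ) (δ : ℝ) : Prop :=
  ∀ x y z w : A,
    min (gromovProduct d x y w) (gromovProduct d y z w) - δ ≤ gromovProduct d x z w

/-- A map `f` from `(A, d)` to `(B, d')` is an `(L, β)`-rough isometry. It is a strict
`β`-rough isometry when `L = 1`. -/
structure IsRoughIsometry {A B : Type*} (d : A → A → ℝ) (d' : B → B → ℝ) (L β : ℝ)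
    (f : A → B) : Prop where
  one_le : 1 ≤ L
  nonneg : 0 ≤ β
  lower : ∀ x y : A, (1 / L) * d x y - β ≤ d' (f x) (f y)
  upper : ∀ x y : A, d' (f x) (f y) ≤ L * d x y + β
  cobounded : ∃ M : ℝ, ∀ z : B, ∃ x : A, d' (f x) z ≤ M

/-- `(a, b)`-pinched exponential growth at infinity of the measures of the open balls of the
distance `d`. -/
def HasPinchedGrowth {A : Type*} [MeasurableSpace A] (d : A → A → ℝ) (μ : Measure A)
    (a b : ℝ) : Prop :=
  ∃ c C : ℝ, 0 < c ∧ 0 < C ∧ ∀ (x : A) (r : ℝ), 1 ≤ r →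
    ENNReal.ofReal (c * a ^ r) ≤ μ {y | d x y < r} ∧
      μ {y | d x y < r} ≤ ENNReal.ofReal (C * b ^ r)

/-- The metric is strictly intrinsic: any two points are joined by a continuous path whose length
(total variation) equals their distance. -/
def IsStrictlyIntrinsic (X : Type*) [MetricSpace X] : Prop :=
  ∀ x y : X, ∃ γ : Path x y, eVariationOn (fun t => γ t) Set.univ = edist x y

/-- The local doubling property: all balls have positive and finite measure, and the doubling
inequality holds uniformly for all balls of radius at most `s`, for each `s > 0`. -/
structure IsLocallyDoubling {X : Type*} [MetricSpace X] [MeasurableSpace X]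
    (μ : Measure X) : Prop where
  pos : ∀ (x : X) (r : ℝ), 0 < r → 0 < μ (Metric.ball x r)
  finite : ∀ (x : X) (r : ℝ), 0 < r → μ (Metric.ball x r) < ∞
  doubling : ∀ s : ℝ, 0 < s → ∃ L : ℝ≥0, ∀ (x : X) (r : ℝ), 0 < r → r ≤ s →
    μ (Metric.ball x (2 * r)) ≤ L * μ (Metric.ball x r)

/-- The class of connected noncompact complete `δ`-hyperbolic length spaces, with strictly
intrinsic metric, endowed with a locally doubling Borel measure with `(a, b)`-pinched exponential
growth at infinity. -/
structure MemClassX (δ a b : ℝ) (X : Type*) [MetricSpace X] [MeasurableSpace X] [BorelSpace X]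
    (μ : Measure X) : Prop where
  connected : ConnectedSpace X
  noncompact : NoncompactSpace X
  complete : CompleteSpace X
  strictlyIntrinsic : IsStrictlyIntrinsic X
  hyperbolic : IsHyperbolic (fun x y : X => dist x y) δ
  locallyDoubling : IsLocallyDoubling μ
  growth : HasPinchedGrowth (fun x y : X => dist x y) μ a b

/-- In the tree `T` with root `o`, the vertex `y` is the predecessor of `x`: the neighbour of `x`
whose level (distance from the root) is one less than that of `x`. -/
def IsPredecessor {V : Type*} (T : SimpleGraph V) (o y x : V) : Prop :=
  T.Adj x y ∧ T.dist o y + 1 = T.dist o x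

/-- The graph `G` is a spider's web obtained from the tree `T` with root `o` by adding edges.
All graphs have finite valences. -/
structure IsSpidersWeb {V : Type*} (T : SimpleGraph V) (o : V) (G : SimpleGraph V) : Prop where
  isTree : T.IsTree
  le : T ≤ G
  finite_valence : ∀ x : V, (G.neighborSet x).Finite
  level_eq_of_new_edge : ∀ x y : V, G.Adj x y → ¬ T.Adj x y → T.dist o x = T.dist o y
  predecessors : ∀ x y : V, G.Adj x y → T.dist o x = T.dist o y →
    ∀ x' y' : V, IsPredecessor T o x' x → IsPredecessor T o y' y → x' = y' ∨ G.Adj x' y'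

/-- The graph distance, as a real-valued function. -/
noncomputable def graphDist {V : Type*} (G : SimpleGraph V) (x y : V) : ℝ := (G.dist x y : ℝ)

/-- The class of `δ`-hyperbolic spider's webs whose counting measure has `(a, b)`-pinched
exponential growth, with respect to the graph distance of the web. -/
structure MemClassUpsilon (δ a b : ℝ) {V : Type*} (T : SimpleGraph V) (o : V)
    (G : SimpleGraph V) : Prop where
  isSpidersWeb : IsSpidersWeb T o G
  hyperbolic : IsHyperbolic (graphDist G) δ
  growth : @HasPinchedGrowth V ⊤ (graphDist G) (@Measure.count V ⊤) a b

end SpidersWeb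

/-!
Take a net `V` in the union of the spheres of integer radius around a root `o`, and let the parent
of a net point be a net point at distance at most `3` on the next smaller sphere. Two net points at
the same level are joined whenever they have close descendants under the same iterate of the parent
map; this is what makes predecessors of adjacent points equal or adjacent.

The key point is that, along a chain whose distance to `o` grows by one at each step, the loss in
the Gromov product is bounded independently of the length of the chain. Hence the ancestors of `x`
stay close to a geodesic from `x` to `o`, and the ancestors of `x` and `y` at the level of the
Gromov product of `x` and `y` are equal or adjacent, which gives a path in the web of length at
most `dist x y + 3`. Conversely, the distance to `o` changes by at most one at each step of a path
in the web. In a path of length `n` from `x` to `y`, split at the point where the resulting lower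
bounds for the distance to `o` meet, both halves lie above chains of the above kind, and
`dist x y ≤ n + O(1)` follows. So the two distances differ by a bounded amount. Hyperbolicity
passes to the web, and so does the growth of balls, which are covered by balls of radius `4` around
net points, while balls of radius `1` around them overlap at most twice.
-/

namespace SpidersWeb

section Hyperbolic

variable {A : Type*} {d : A → A → ℝ} {δ : ℝ}

theorem IsHyperbolic.nonneg [Nonempty A] (h : IsHyperbolic d δ) : 0 ≤ δ := by
  obtain ⟨x⟩ := ‹Nonempty A›
  simpa using h x x x x

theorem IsHyperbolic.sub_le_gromovProduct (h : IsHyperbolic d δ) {x y z o : A} {g : ℝ}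
    (hxy : g ≤ gromovProduct d x y o) (hyz : g ≤ gromovProduct d y z o) :
    g - δ ≤ gromovProduct d x z o := by
  linarith [h x y z o, le_min hxy hyz]

theorem IsHyperbolic.sub_mul_le_gromovProduct_of_chain (h : IsHyperbolic d δ) {o : A}
    {f : ℕ → A} {a : ℝ} {n : ℕ} (hf : ∀ i ≤ n, a ≤ gromovProduct d (f i) (f (i + 1)) o) :
    a - n * δ ≤ gromovProduct d (f 0) (f (n + 1)) o := by
  have : Nonempty A := ⟨o⟩
  induction n with
  | zero => simpa using hf 0 le_rfl
  | succ n ih =>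
    have hinit : a - n * δ ≤ gromovProduct d (f 0) (f (n + 1)) o := ih fun i hi => hf i (by lia)
    have hlast : a - n * δ ≤ gromovProduct d (f (n + 1)) (f (n + 2)) o :=
      (sub_le_self a (mul_nonneg n.cast_nonneg h.nonneg)).trans (hf (n + 1) le_rfl)
    have := h.sub_le_gromovProduct hinit hlast
    push_cast
    linarith

/-- A bound for the loss in the Gromov product of the ends of a chain, of any length, along which
the Gromov products of consecutive points grow by at least one at each step. -/
noncomputable def chainDefect (δ : ℝ) : ℝ := (⌈δ⌉₊ + 1) * δ

theorem chainDefect_nonneg (hδ : 0 ≤ δ) : 0 ≤ chainDefect δ := by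
  unfold chainDefect
  positivity

theorem IsHyperbolic.sub_chainDefect_le_gromovProduct (h : IsHyperbolic d δ) {o : A}
    {f : ℕ → A} {a : ℝ} {n : ℕ} (hf : ∀ i ≤ n, a + i ≤ gromovProduct d (f i) (f (i + 1)) o) :
    a - chainDefect δ ≤ gromovProduct d (f 0) (f (n + 1)) o := by
  have hδ : 0 ≤ δ := have : Nonempty A := ⟨o⟩; h.nonneg
  set K : ℕ := ⌈δ⌉₊
  have hδK : δ ≤ K := Nat.le_ceil δ
  have hflat : ∀ m ≤ n, a - m * δ ≤ gromovProduct d (f 0) (f (m + 1)) o := fun m hm =>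
    h.sub_mul_le_gromovProduct_of_chain fun i hi =>
      (le_add_of_nonneg_right i.cast_nonneg).trans (hf i (hi.trans hm))
  unfold chainDefect
  induction n using Nat.strong_induction_on generalizing f a with
  | _ n ih =>
  rcases le_or_gt n K with hn | hn
  · have : n * δ ≤ K * δ := by gcongr
    linarith [hflat n le_rfl]
  -- The gain `K + 1 ≥ δ` over the first block absorbs the loss of gluing the rest to it.
  · obtain ⟨m, rfl⟩ : ∃ m, n = K + 1 + m := Nat.exists_eq_add_of_le hn
    have hblock : a - K * δ ≤ gromovProduct d (f 0) (f (K + 1)) o := hflat K hn.le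
    have hshift : ∀ i ≤ m, a + (K + 1) + i ≤
        gromovProduct d (f (K + 1 + i)) (f (K + 1 + (i + 1))) o := fun i hi => by
      simpa [add_assoc] using hf (K + 1 + i) (by lia)
    have hrest := ih m (by lia) (f := fun i => f (K + 1 + i)) (a := a + (K + 1)) hshift
      fun j hj => h.sub_mul_le_gromovProduct_of_chain fun i hi =>
        (le_add_of_nonneg_right i.cast_nonneg).trans (hshift i (hi.trans hj))
    have := h.sub_le_gromovProduct hblock (hrest.trans' (by linarith))
    rw [add_assoc]
    linarith

theorem IsHyperbolic.of_abs_sub_le {d' : A → A → ℝ} {β : ℝ} (h : IsHyperbolic d δ)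
    (hd : ∀ x y, |d' x y - d x y| ≤ β) : IsHyperbolic d' (δ + 3 * β) := by
  have hprod (x y w : A) : |gromovProduct d' x y w - gromovProduct d x y w| ≤ 3 / 2 * β := by
    have hwx := abs_le.1 (hd w x)
    have hwy := abs_le.1 (hd w y)
    have hxy := abs_le.1 (hd x y)
    unfold gromovProduct
    exact abs_le.2 ⟨by linarith, by linarith⟩
  intro x y z w
  have hxy := abs_le.1 (hprod x y w)
  have hyz := abs_le.1 (hprod y z w)
  have hxz := abs_le.1 (hprod x z w)
  set g := min (gromovProduct d' x y w) (gromovProduct d' y z w)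
  have hgxy : g ≤ gromovProduct d' x y w := min_le_left _ _
  have hgyz : g ≤ gromovProduct d' y z w := min_le_right _ _
  have := h.sub_le_gromovProduct (x := x) (y := y) (z := z) (o := w) (g := g - 3 / 2 * β)
    (by linarith) (by linarith)
  linarith

end Hyperbolic

section HyperbolicDist

variable {A : Type*} [PseudoMetricSpace A] {δ D : ℝ} {o : A}

theorem gromovProduct_dist_comm (x y o : A) :
    gromovProduct dist x y o = gromovProduct dist y x o := by
  unfold gromovProduct
  rw [dist_comm x y, add_comm (dist o x)]

theorem gromovProduct_dist_nonneg (x y o : A) : 0 ≤ gromovProduct dist x y o := by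
  unfold gromovProduct
  linarith [dist_triangle_left x y o]

theorem gromovProduct_dist_le_left (x y o : A) : gromovProduct dist x y o ≤ dist o x := by
  unfold gromovProduct
  linarith [dist_triangle o x y]

theorem gromovProduct_dist_le_right (x y o : A) : gromovProduct dist x y o ≤ dist o y :=
  gromovProduct_dist_comm x y o ▸ gromovProduct_dist_le_left y x o

theorem dist_sub_dist_le_gromovProduct (x y o : A) :
    dist o x - dist x y ≤ gromovProduct dist x y o := by
  unfold gromovProduct
  linarith [dist_triangle_right o x y]

theorem dist_eq_add_sub_gromovProduct (x y o : A) :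
    dist x y = dist o x + dist o y - 2 * gromovProduct dist x y o := by
  unfold gromovProduct
  ring

theorem IsHyperbolic.sub_le_gromovProduct_of_steps (h : IsHyperbolic (A := A) dist δ)
    (hD : 0 ≤ D) {f : ℕ → A} {a : ℝ} {n : ℕ} (hstep : ∀ i < n, dist (f i) (f (i + 1)) ≤ D)
    (hdepth : ∀ i ≤ n, a + i ≤ dist o (f i)) :
    a - (D + chainDefect δ) ≤ gromovProduct dist (f 0) (f n) o := by
  cases n with
  | zero =>
    have : Nonempty A := ⟨o⟩
    have hself := dist_sub_dist_le_gromovProduct (f 0) (f 0) o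
    have hdepth0 := hdepth 0 le_rfl
    rw [dist_self] at hself
    push_cast at hdepth0
    linarith [chainDefect_nonneg h.nonneg]
  | succ n =>
    have hconsecutive (i : ℕ) (hi : i ≤ n) :
        a - D + i ≤ gromovProduct dist (f i) (f (i + 1)) o := by
      linarith [hdepth i (by lia), hstep i (by lia),
        dist_sub_dist_le_gromovProduct (f i) (f (i + 1)) o]
    linarith [h.sub_chainDefect_le_gromovProduct hconsecutive]

theorem abs_dist_sub_dist_le_of_steps {f : ℕ → A} {n : ℕ}
    (hlip : ∀ i < n, |dist o (f i) - dist o (f (i + 1))| ≤ 1) {i j : ℕ} (hij : i ≤ j)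
    (hjn : j ≤ n) : |dist o (f i) - dist o (f j)| ≤ j - i := by
  have := dist_le_Ico_sum_of_dist_le (f := fun k => dist o (f k)) hij (d := fun _ => 1)
    fun {k} _ hk => hlip k (hk.trans_le hjn)
  simpa [Nat.cast_sub hij, Real.dist_eq] using this

theorem IsHyperbolic.dist_le_add_of_steps (h : IsHyperbolic (A := A) dist δ) (hD : 0 ≤ D)
    {f : ℕ → A} {n : ℕ} (hstep : ∀ i < n, dist (f i) (f (i + 1)) ≤ D)
    (hlip : ∀ i < n, |dist o (f i) - dist o (f (i + 1))| ≤ 1) :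
    dist (f 0) (f n) ≤ n + 2 * (D + chainDefect δ + δ + 1) := by
  have hends := abs_le.1 (abs_dist_sub_dist_le_of_steps hlip n.zero_le le_rfl)
  rw [Nat.cast_zero, sub_zero] at hends
  -- `f t` is the point at which the two lower bounds for the distance to `o`, coming from the
  -- two ends, agree up to rounding; from there, the bounds increase in both directions.
  set t : ℕ := ⌊(dist o (f 0) + n - dist o (f n)) / 2⌋₊
  set q : ℝ := (dist o (f 0) + dist o (f n) - n) / 2 with hq
  have ht_le : (t : ℝ) ≤ (dist o (f 0) + n - dist o (f n)) / 2 := Nat.floor_le (by linarith)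
  have ht_gt : (dist o (f 0) + n - dist o (f n)) / 2 < t + 1 := Nat.lt_floor_add_one _
  have htn : t ≤ n := mod_cast (by linarith : (t : ℝ) ≤ n)
  have hback : q - 1 - (D + chainDefect δ) ≤ gromovProduct dist (f t) (f 0) o := by
    have := h.sub_le_gromovProduct_of_steps (o := o) hD (f := fun i => f (t - i)) (a := q - 1)
      (n := t) (fun i hi => ?_) fun i hi => ?_
    · simpa using this
    · rw [dist_comm, show t - i = t - (i + 1) + 1 by lia]
      exact hstep _ (by lia)
    · have := (abs_le.1 (abs_dist_sub_dist_le_of_steps hlip (t - i).zero_le (by lia))).2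
      push_cast [hi] at this
      linarith
  have hforth : q - 1 - (D + chainDefect δ) ≤ gromovProduct dist (f t) (f n) o := by
    have := h.sub_le_gromovProduct_of_steps (o := o) hD (f := fun i => f (t + i)) (a := q - 1)
      (n := n - t) (fun i hi => hstep _ (by lia)) fun i hi => ?_
    · simpa [htn] using this
    · have := (abs_le.1 (abs_dist_sub_dist_le_of_steps hlip (i := t + i) (j := n) (by lia)
        le_rfl)).1
      push_cast at this
      linarith
  rw [gromovProduct_dist_comm] at hback
  have := h.sub_le_gromovProduct hback hforth
  linarith [dist_eq_add_sub_gromovProduct (f 0) (f n) o]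

end HyperbolicDist

section ParentMap

variable {V : Type*}

/-- A parent map on a set graded by `lev` with `o` as its only point of level `0`: the parent of a
point lies one level below it. By truncated subtraction, the point `o` is its own parent. -/
structure IsParentMap (o : V) (lev : V → ℕ) (par : V → V) : Prop where
  lev_eq_zero_iff : ∀ x, lev x = 0 ↔ x = o
  lev_par : ∀ x, lev (par x) = lev x - 1

/-- The graph joining each point to its parent; it is a tree for a parent map. -/
def parentTree (par : V → V) : SimpleGraph V :=
  SimpleGraph.fromRel fun x y => par x = y

variable {o : V} {lev : V → ℕ} {par : V → V}

theorem parentTree_adj {x y : V} :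
    (parentTree par).Adj x y ↔ x ≠ y ∧ (par x = y ∨ par y = x) :=
  SimpleGraph.fromRel_adj _ _ _

theorem exists_parentTree_walk_iterate (par : V → V) (j : ℕ) (x : V) :
    ∃ p : (parentTree par).Walk x (par^[j] x), p.length ≤ j := by
  induction j generalizing x with
  | zero => exact ⟨.nil, le_rfl⟩
  | succ j ih =>
    rw [Function.iterate_succ_apply]
    obtain ⟨p, hp⟩ := ih (par x)
    by_cases hx : x = par x
    · exact ⟨p.copy hx.symm rfl, by simpa using hp.trans j.le_succ⟩
    · exact ⟨.cons (parentTree_adj.2 ⟨hx, .inl rfl⟩) p, by simpa using hp⟩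

theorem dist_iterate_le_of_parentTree_le {G : SimpleGraph V} (hG : parentTree par ≤ G) (j : ℕ)
    (x : V) : G.dist x (par^[j] x) ≤ j := by
  obtain ⟨p, hp⟩ := exists_parentTree_walk_iterate par j x
  exact (SimpleGraph.dist_le (p.mapLe hG)).trans (by simpa using hp)

theorem exists_iterate_eq_of_walk_deleteEdges {x y z : V}
    (p : ((parentTree par).deleteEdges {s(x, par x)}).Walk y z) (hy : ∃ k, par^[k] y = x) :
    ∃ k, par^[k] z = x := by
  induction p with
  | nil => exact hy
  | @cons y y' _ hadj _ ih =>
    obtain ⟨k, hk⟩ := hy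
    rw [SimpleGraph.deleteEdges_adj, parentTree_adj] at hadj
    obtain ⟨⟨-, rfl | rfl⟩, hdel⟩ := hadj
    · cases k with
      | zero => exact absurd (by simp [← hk]) hdel
      | succ k => exact ih ⟨k, hk⟩
    · exact ih ⟨k + 1, hk⟩

namespace IsParentMap

theorem lev_iterate (h : IsParentMap o lev par) (j : ℕ) (x : V) :
    lev (par^[j] x) = lev x - j := by
  induction j with
  | zero => rfl
  | succ j ih => rw [Function.iterate_succ_apply', h.lev_par, ih, Nat.sub_sub]

theorem iterate_eq_root (h : IsParentMap o lev par) {j : ℕ} {x : V} (hj : lev x ≤ j) :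
    par^[j] x = o := by
  rw [← h.lev_eq_zero_iff, h.lev_iterate, Nat.sub_eq_zero_of_le hj]

theorem par_eq_self_iff (h : IsParentMap o lev par) {x : V} : par x = x ↔ lev x = 0 := by
  refine ⟨fun hpar => ?_, fun hlev => ?_⟩
  · have := h.lev_par x
    rw [hpar] at this
    lia
  · have hpar : par x = o := h.iterate_eq_root (j := 1) (by lia)
    rw [hpar, (h.lev_eq_zero_iff x).1 hlev]

theorem connected (h : IsParentMap o lev par) : (parentTree par).Connected :=
  SimpleGraph.connected_iff_exists_forall_reachable _ |>.2 ⟨o, fun x => by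
    obtain ⟨p, -⟩ := exists_parentTree_walk_iterate par (lev x) x
    rw [h.iterate_eq_root le_rfl] at p
    exact p.reachable.symm⟩

theorem isBridge (h : IsParentMap o lev par) {x : V} (hx : par x ≠ x) :
    (parentTree par).IsBridge s(x, par x) := by
  rw [SimpleGraph.isBridge_iff]
  rintro ⟨p⟩
  -- Without this edge the component of `x` consists of its descendants.
  obtain ⟨k, hk⟩ := exists_iterate_eq_of_walk_deleteEdges p ⟨0, rfl⟩
  have hlev := h.lev_iterate k (par x)
  rw [hk, h.lev_par] at hlev
  exact hx (h.par_eq_self_iff.2 (by lia))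

theorem isTree (h : IsParentMap o lev par) : (parentTree par).IsTree := by
  refine ⟨h.connected, SimpleGraph.isAcyclic_iff_forall_adj_isBridge.2 fun x y hxy => ?_⟩
  obtain ⟨hne, rfl | rfl⟩ := parentTree_adj.1 hxy
  · exact h.isBridge hne.symm
  · rw [Sym2.eq_swap]
    exact h.isBridge hne

theorem lev_le_succ_of_adj (h : IsParentMap o lev par) {x y : V} (hxy : (parentTree par).Adj x y) :
    lev y ≤ lev x + 1 := by
  obtain ⟨-, rfl | rfl⟩ := parentTree_adj.1 hxy
  · have := h.lev_par x
    lia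
  · have := h.lev_par y
    lia

theorem lev_le_add_length (h : IsParentMap o lev par) {x y : V} (p : (parentTree par).Walk x y) :
    lev y ≤ lev x + p.length := by
  induction p with
  | nil => simp
  | cons hadj _ ih =>
    have := h.lev_le_succ_of_adj hadj
    rw [SimpleGraph.Walk.length_cons]
    lia

theorem dist_root_eq_lev (h : IsParentMap o lev par) (x : V) :
    (parentTree par).dist o x = lev x := by
  apply le_antisymm
  · have := dist_iterate_le_of_parentTree_le (par := par) le_rfl (lev x) x
    rwa [h.iterate_eq_root le_rfl, SimpleGraph.dist_comm] at this
  · obtain ⟨p, hp⟩ := (h.connected o x).exists_walk_length_eq_dist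
    have hlev := h.lev_le_add_length p
    rwa [(h.lev_eq_zero_iff o).2 rfl, zero_add, hp] at hlev

theorem isPredecessor_iff (h : IsParentMap o lev par) {x y : V} :
    IsPredecessor (parentTree par) o y x ↔ lev x ≠ 0 ∧ y = par x := by
  have hx := h.lev_par x
  have hy := h.lev_par y
  rw [IsPredecessor, h.dist_root_eq_lev, h.dist_root_eq_lev, parentTree_adj]
  constructor
  · rintro ⟨⟨-, rfl | rfl⟩, hlev⟩
    · exact ⟨by lia, rfl⟩
    · lia
  · rintro ⟨hlev, rfl⟩
    exact ⟨⟨fun hpar => hlev (h.par_eq_self_iff.1 hpar.symm), .inl rfl⟩, by lia⟩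

end IsParentMap

variable [PseudoMetricSpace V] {R : ℝ}

/-- The graph joining distinct points of the same level which, for some `k`, have `k`-th
descendants at distance at most `R` from each other. -/
def cousinGraph (lev : V → ℕ) (par : V → V) (R : ℝ) : SimpleGraph V where
  Adj x y := x ≠ y ∧ lev x = lev y ∧
    ∃ (k : ℕ) (u v : V), par^[k] u = x ∧ par^[k] v = y ∧ dist u v ≤ R
  symm := ⟨fun _ _ ⟨hne, hlev, k, u, v, hu, hv, huv⟩ =>
    ⟨hne.symm, hlev.symm, k, v, u, hv, hu, by rwa [dist_comm]⟩⟩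
  loopless := ⟨fun _ h => h.1 rfl⟩

/-- The spider's web obtained from the parent tree by adding the edges between cousins. -/
def parentWeb (lev : V → ℕ) (par : V → V) (R : ℝ) : SimpleGraph V :=
  parentTree par ⊔ cousinGraph lev par R

theorem cousinGraph_adj_iterate {u v : V} {k : ℕ} (hlev : lev (par^[k] u) = lev (par^[k] v))
    (huv : dist u v ≤ R) (hne : par^[k] u ≠ par^[k] v) :
    (cousinGraph lev par R).Adj (par^[k] u) (par^[k] v) :=
  ⟨hne, hlev, k, u, v, rfl, rfl, huv⟩

theorem IsParentMap.isSpidersWeb (h : IsParentMap o lev par)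
    (hfin : ∀ x, ((parentWeb lev par R).neighborSet x).Finite) :
    IsSpidersWeb (parentTree par) o (parentWeb lev par R) where
  isTree := h.isTree
  le := le_sup_left
  finite_valence := hfin
  level_eq_of_new_edge x y hxy hT := by
    rw [h.dist_root_eq_lev, h.dist_root_eq_lev]
    exact (hxy.resolve_left hT).2.1
  predecessors x y hxy hlev x' y' hx' hy' := by
    rw [h.dist_root_eq_lev, h.dist_root_eq_lev] at hlev
    obtain ⟨hx, rfl⟩ := h.isPredecessor_iff.1 hx'
    obtain ⟨hy, rfl⟩ := h.isPredecessor_iff.1 hy'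
    have hpx := h.lev_par x
    have hpy := h.lev_par y
    obtain hT | ⟨-, -, k, u, v, rfl, rfl, huv⟩ := hxy
    · obtain ⟨-, rfl | rfl⟩ := parentTree_adj.1 hT <;> lia
    · refine or_iff_not_imp_left.2 fun hne => .inr ?_
      simp only [← Function.iterate_succ_apply' par] at hne hpx hpy ⊢
      exact cousinGraph_adj_iterate (by lia) huv hne

end ParentMap

section Comparison

variable {V : Type*} [PseudoMetricSpace V] {o : V} {lev : V → ℕ} {par : V → V} {s R δ : ℝ}

/-- A parent map whose levels are the distances to `o` and which moves points by at most `s`. -/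
structure IsRadialParentMap (o : V) (lev : V → ℕ) (par : V → V) (s : ℝ) : Prop extends
    IsParentMap o lev par where
  dist_root : ∀ x, dist o x = lev x
  dist_par_le : ∀ x, dist x (par x) ≤ s

/-- A bound for the amount by which the Gromov product of `x` and its ancestor `par^[j] x` falls
short of `lev (par^[j] x)`, its largest possible value. -/
noncomputable def ancestorDefect (δ s : ℝ) : ℝ := s + chainDefect δ

/-- A radius `R` such that the ancestors of any two points at a level at most their Gromov product
are equal or adjacent in `parentWeb lev par R`. -/
noncomputable def webRadius (δ s : ℝ) : ℝ := 2 * ancestorDefect δ s + 4 * δ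

/-- A bound for the difference between the distance and the graph distance of the web of radius
`webRadius δ s`. -/
noncomputable def webDefect (δ s : ℝ) : ℝ :=
  2 * (webRadius δ s + 4 * δ + chainDefect δ + δ) + 3

theorem ancestorDefect_nonneg (hδ : 0 ≤ δ) (hs : 0 ≤ s) : 0 ≤ ancestorDefect δ s :=
  add_nonneg hs (chainDefect_nonneg hδ)

theorem webRadius_nonneg (hδ : 0 ≤ δ) (hs : 0 ≤ s) : 0 ≤ webRadius δ s := by
  unfold webRadius
  linarith [ancestorDefect_nonneg hδ hs]

theorem three_le_webDefect (hδ : 0 ≤ δ) (hs : 0 ≤ s) : 3 ≤ webDefect δ s := by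
  unfold webDefect
  linarith [webRadius_nonneg hδ hs, chainDefect_nonneg hδ]

namespace IsRadialParentMap

theorem nonneg (h : IsRadialParentMap o lev par s) : 0 ≤ s :=
  dist_nonneg.trans (h.dist_par_le o)

theorem abs_dist_root_sub_le_one (h : IsRadialParentMap o lev par s) {x y : V}
    (hxy : (parentWeb lev par R).Adj x y) :
    |dist o x - dist o y| ≤ 1 := by
  rw [h.dist_root, h.dist_root]
  obtain hT | ⟨-, hlev, -⟩ := hxy
  · have hxy : (lev x : ℝ) ≤ lev y + 1 := mod_cast h.lev_le_succ_of_adj hT.symm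
    have hyx : (lev y : ℝ) ≤ lev x + 1 := mod_cast h.lev_le_succ_of_adj hT
    exact abs_sub_le_iff.2 ⟨by linarith, by linarith⟩
  · simp [hlev]

variable (h : IsRadialParentMap o lev par s) (hyp : IsHyperbolic (A := V) dist δ)
include h hyp

theorem sub_le_gromovProduct_iterate (j : ℕ) (x : V) :
    lev (par^[j] x) - ancestorDefect δ s ≤ gromovProduct dist (par^[j] x) x o := by
  have : Nonempty V := ⟨o⟩
  rcases le_or_gt j (lev x) with hj | hj
  · have hlev := h.lev_iterate j x
    have := hyp.sub_le_gromovProduct_of_steps (o := o) h.nonneg (f := fun i => par^[j - i] x)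
      (a := lev (par^[j] x)) (n := j) (fun i hi => ?_) fun i hi => ?_
    · simpa [ancestorDefect] using this
    · rw [dist_comm, show j - i = j - (i + 1) + 1 by lia, Function.iterate_succ_apply']
      exact h.dist_par_le _
    · rw [h.dist_root, h.lev_iterate (j - i)]
      exact_mod_cast (by lia : lev (par^[j] x) + i ≤ lev x - (j - i))
  · have hlev : lev (par^[j] x) = 0 := by rw [h.lev_iterate, Nat.sub_eq_zero_of_le hj.le]
    rw [hlev, Nat.cast_zero]
    linarith [gromovProduct_dist_nonneg (par^[j] x) x o, ancestorDefect_nonneg hyp.nonneg h.nonneg]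

theorem dist_iterate_le {x y : V} {i j : ℕ} {E : ℝ} (hE : ancestorDefect δ s ≤ E)
    (hlev : lev (par^[i] x) = lev (par^[j] y))
    (hxy : lev (par^[i] x) - E ≤ gromovProduct dist x y o) :
    dist (par^[i] x) (par^[j] y) ≤ 2 * E + 4 * δ := by
  have : Nonempty V := ⟨o⟩
  have hx := h.sub_le_gromovProduct_iterate hyp i x
  have hy := h.sub_le_gromovProduct_iterate hyp j y
  rw [gromovProduct_dist_comm] at hy
  have hxy' : lev (par^[i] x) - E - δ ≤ gromovProduct dist (par^[i] x) y o :=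
    hyp.sub_le_gromovProduct (by linarith) hxy
  have := hyp.sub_le_gromovProduct hxy' (by rw [hlev]; linarith [hyp.nonneg])
  rw [dist_eq_add_sub_gromovProduct _ _ o, h.dist_root, h.dist_root, ← hlev]
  linarith

theorem dist_le_of_parentWeb_adj {x y : V} (hxy : (parentWeb lev par (webRadius δ s)).Adj x y) :
    dist x y ≤ webRadius δ s + 4 * δ := by
  have : Nonempty V := ⟨o⟩
  have hδ := hyp.nonneg
  obtain hT | ⟨-, hlev, k, u, v, rfl, rfl, huv⟩ := hxy
  · have hs : dist x y ≤ s := by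
      obtain ⟨-, rfl | rfl⟩ := parentTree_adj.1 hT
      · exact h.dist_par_le x
      · exact dist_comm (par y) y ▸ h.dist_par_le y
    have := h.nonneg
    have := chainDefect_nonneg hδ
    unfold webRadius ancestorDefect
    linarith
  · have hu : (lev (par^[k] u) : ℝ) ≤ lev u := mod_cast h.lev_iterate k u ▸ Nat.sub_le _ _
    have hv : (lev (par^[k] u) : ℝ) ≤ lev v :=
      mod_cast hlev ▸ h.lev_iterate k v ▸ Nat.sub_le _ _
    have hprod := dist_eq_add_sub_gromovProduct u v o
    rw [h.dist_root, h.dist_root] at hprod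
    unfold webRadius at huv ⊢
    have := h.dist_iterate_le hyp (E := ancestorDefect δ s + 2 * δ) (by linarith) hlev
      (by linarith)
    linarith

theorem dist_le_graphDist_add (x y : V) :
    dist x y ≤ graphDist (parentWeb lev par (webRadius δ s)) x y + webDefect δ s := by
  have : Nonempty V := ⟨o⟩
  have hconn : (parentWeb lev par (webRadius δ s)).Connected := h.connected.mono le_sup_left
  obtain ⟨p, hp⟩ := (hconn x y).exists_walk_length_eq_dist
  have hR : 0 ≤ webRadius δ s + 4 * δ := by
    linarith [webRadius_nonneg hyp.nonneg h.nonneg, hyp.nonneg]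
  have := hyp.dist_le_add_of_steps (o := o) hR (f := p.getVert) (n := p.length)
    (fun i hi => h.dist_le_of_parentWeb_adj hyp (p.adj_getVert_succ hi))
    fun i hi => h.abs_dist_root_sub_le_one (p.adj_getVert_succ hi)
  rw [p.getVert_zero, p.getVert_length, hp] at this
  unfold graphDist webDefect
  linarith

theorem graphDist_iterate_le_one {x y : V} {i j : ℕ} (hlev : lev (par^[i] x) = lev (par^[j] y))
    (hxy : lev (par^[i] x) ≤ gromovProduct dist x y o) :
    graphDist (parentWeb lev par (webRadius δ s)) (par^[i] x) (par^[j] y) ≤ 1 := by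
  have : Nonempty V := ⟨o⟩
  have hnear : dist (par^[i] x) (par^[j] y) ≤ webRadius δ s :=
    h.dist_iterate_le hyp le_rfl hlev
      (by linarith [ancestorDefect_nonneg hyp.nonneg h.nonneg])
  unfold graphDist
  by_cases hne : par^[i] x = par^[j] y
  · simp [hne]
  · have hadj : (parentWeb lev par (webRadius δ s)).Adj (par^[i] x) (par^[j] y) :=
      .inr (cousinGraph_adj_iterate (k := 0) hlev hnear hne)
    exact_mod_cast (SimpleGraph.dist_eq_one_iff_adj.2 hadj).le

theorem graphDist_le_dist_add_three (x y : V) :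
    graphDist (parentWeb lev par (webRadius δ s)) x y ≤ dist x y + 3 := by
  set G := parentWeb lev par (webRadius δ s)
  set g := gromovProduct dist x y o
  have hg : ⌊g⌋₊ ≤ g := Nat.floor_le (gromovProduct_dist_nonneg x y o)
  obtain ⟨i, hi⟩ : ∃ i, lev x = ⌊g⌋₊ + i := Nat.exists_eq_add_of_le <| Nat.floor_le_of_le <|
    h.dist_root x ▸ gromovProduct_dist_le_left x y o
  obtain ⟨j, hj⟩ : ∃ j, lev y = ⌊g⌋₊ + j := Nat.exists_eq_add_of_le <| Nat.floor_le_of_le <|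
    h.dist_root y ▸ gromovProduct_dist_le_right x y o
  have hix : lev (par^[i] x) = ⌊g⌋₊ := by rw [h.lev_iterate]; lia
  have hjy : lev (par^[j] y) = ⌊g⌋₊ := by rw [h.lev_iterate]; lia
  have hpath : graphDist G x y ≤ i + 1 + j := calc
    graphDist G x y ≤ graphDist G x (par^[i] x) + graphDist G (par^[i] x) (par^[j] y)
        + graphDist G (par^[j] y) y := by
      have hconn : G.Connected := h.connected.mono le_sup_left
      unfold graphDist
      exact_mod_cast hconn.dist_triangle.trans (by gcongr; exact hconn.dist_triangle)
    _ ≤ i + 1 + j := by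
      gcongr
      · exact Nat.cast_le.2 (dist_iterate_le_of_parentTree_le le_sup_left i x)
      · exact h.graphDist_iterate_le_one hyp (hix.trans hjy.symm) (by rwa [hix])
      · exact Nat.cast_le.2 (G.dist_comm ▸ dist_iterate_le_of_parentTree_le le_sup_left j y)
  have hxy := dist_eq_add_sub_gromovProduct x y o
  rw [h.dist_root, h.dist_root, hi, hj] at hxy
  push_cast at hxy
  linarith [Nat.lt_floor_add_one g]

theorem abs_graphDist_sub_dist_le (x y : V) :
    |graphDist (parentWeb lev par (webRadius δ s)) x y - dist x y| ≤ webDefect δ s := by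
  have : Nonempty V := ⟨o⟩
  have h3 : 3 ≤ webDefect δ s := three_le_webDefect hyp.nonneg h.nonneg
  have := h.dist_le_graphDist_add hyp x y
  have := h.graphDist_le_dist_add_three hyp x y
  exact abs_sub_le_iff.2 ⟨by linarith, by linarith⟩

end IsRadialParentMap

end Comparison

section RadialNet

variable {X : Type*} [MetricSpace X] {o : X} {V : Set X}

theorem IsStrictlyIntrinsic.exists_dist_eq (h : IsStrictlyIntrinsic X) (x y : X) {t : ℝ}
    (ht0 : 0 ≤ t) (ht : t ≤ dist x y) : ∃ z, dist x z = t ∧ dist z y = dist x y - t := by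
  obtain ⟨γ, hγ⟩ := h x y
  have hcont : Continuous fun s => dist x (γ s) := by fun_prop
  obtain ⟨s, hs⟩ : ∃ s, dist x (γ s) = t :=
    intermediate_value_univ (0 : unitInterval) 1 hcont (by simpa using ⟨ht0, ht⟩)
  have hleft : edist x (γ s) ≤ eVariationOn (fun t => γ t) (Set.Iic s) := by
    simpa using eVariationOn.edist_le (fun t => γ t) (s := Set.Iic s) (x := 0) (y := s)
      unitInterval.nonneg' Set.self_mem_Iic
  have hright : edist (γ s) y ≤ eVariationOn (fun t => γ t) (Set.Ici s) := by
    simpa using eVariationOn.edist_le (fun t => γ t) (s := Set.Ici s) (x := s) (y := 1)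
      Set.self_mem_Ici unitInterval.le_one'
  have hsum : edist x (γ s) + edist (γ s) y ≤ edist x y := calc
    _ ≤ _ := add_le_add hleft hright
    _ ≤ eVariationOn (fun t => γ t) (Set.Iic s ∪ Set.Ici s) :=
      eVariationOn.add_le_union _ fun _ ha _ hb => le_trans ha hb
    _ = edist x y := by rw [Set.Iic_union_Ici, hγ]
  rw [edist_dist, edist_dist, edist_dist, ← ENNReal.ofReal_add dist_nonneg dist_nonneg,
    ENNReal.ofReal_le_ofReal_iff dist_nonneg] at hsum
  exact ⟨γ s, hs, by linarith [dist_triangle x (γ s) y]⟩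

theorem exists_subset_pairwise_le_dist {X : Type*} [PseudoMetricSpace X] (S : Set X) {ε : ℝ}
    (hε : 0 < ε) :
    ∃ V ⊆ S, (V.Pairwise fun x y => ε ≤ dist x y) ∧ ∀ x ∈ S, ∃ v ∈ V, dist x v < ε := by
  obtain ⟨V, hV⟩ := zorn_subset {V : Set X | V ⊆ S ∧ V.Pairwise fun x y => ε ≤ dist x y}
    fun c hc hchain => ⟨⋃₀ c, ⟨Set.sUnion_subset fun s hs => (hc hs).1,
      (Set.pairwise_sUnion hchain.directedOn).2 fun s hs => (hc hs).2⟩,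
      fun s hs => Set.subset_sUnion_of_mem hs⟩
  refine ⟨V, hV.prop.1, hV.prop.2, fun x hx => ?_⟩
  by_contra! hfar
  have hxV : x ∈ V := hV.mem_of_prop_insert ⟨Set.insert_subset hx hV.prop.1,
    hV.prop.2.insert fun v hv _ => ⟨hfar v hv, dist_comm x v ▸ hfar v hv⟩⟩
  exact absurd (hfar x hxV) (by simpa using hε)

/-- A net for the spheres of integer radius around `o`: it lies in the union of these spheres, and
its intersection with each of them is `2`-separated and `2`-dense in it. -/
structure IsRadialNet (o : X) (V : Set X) : Prop where
  dist_root : ∀ v ∈ V, ∃ n : ℕ, dist o v = n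
  two_le_dist : ∀ v ∈ V, ∀ w ∈ V, v ≠ w → dist o v = dist o w → 2 ≤ dist v w
  exists_dist_le_two : ∀ (x : X) (n : ℕ), dist o x = n → ∃ v ∈ V, dist o v = n ∧ dist x v ≤ 2

theorem exists_isRadialNet (o : X) : ∃ V, IsRadialNet o V := by
  choose V hsub hsep hdense using fun n : ℕ =>
    exists_subset_pairwise_le_dist {x | dist o x = n} two_pos
  refine ⟨⋃ n, V n, fun v hv => ?_, fun v hv w hw hne heq => ?_, fun x n hx => ?_⟩
  · obtain ⟨n, hv⟩ := Set.mem_iUnion.1 hv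
    exact ⟨n, hsub n hv⟩
  · obtain ⟨n, hv⟩ := Set.mem_iUnion.1 hv
    obtain ⟨m, hw⟩ := Set.mem_iUnion.1 hw
    obtain rfl : n = m := by
      rw [show dist o v = n from hsub n hv, show dist o w = m from hsub m hw] at heq
      exact_mod_cast heq
    exact hsep n hv hw hne
  · obtain ⟨v, hv, hxv⟩ := hdense n x hx
    exact ⟨v, Set.mem_iUnion_of_mem n hv, hsub n hv, hxv.le⟩

namespace IsRadialNet

theorem root_mem (h : IsRadialNet o V) : o ∈ V := by
  obtain ⟨v, hv, hov, -⟩ := h.exists_dist_le_two o 0 (by simp)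
  rwa [dist_eq_zero.1 (hov.trans Nat.cast_zero)]

theorem natCast_floor_dist (h : IsRadialNet o V) {v : X} (hv : v ∈ V) :
    (⌊dist o v⌋₊ : ℝ) = dist o v := by
  obtain ⟨n, hn⟩ := h.dist_root v hv
  rw [hn, Nat.floor_natCast]

theorem dist_floor_dist_le (h : IsRadialNet o V) {v w : X} (hv : v ∈ V) (hw : w ∈ V) :
    dist ⌊dist o v⌋₊ ⌊dist o w⌋₊ ≤ dist v w := by
  rw [Nat.dist_eq, h.natCast_floor_dist hv, h.natCast_floor_dist hw, dist_comm o v, dist_comm o w]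
  exact abs_dist_sub_le v w o

theorem pairwise_one_le_dist (h : IsRadialNet o V) : V.Pairwise fun v w => 1 ≤ dist v w := by
  intro v hv w hw hne
  by_cases heq : dist o v = dist o w
  · linarith [h.two_le_dist v hv w hw hne heq]
  · have hfloor : ⌊dist o v⌋₊ ≠ ⌊dist o w⌋₊ := fun hfloor => heq <| by
      rw [← h.natCast_floor_dist hv, hfloor, h.natCast_floor_dist hw]
    exact (Nat.pairwise_one_le_dist hfloor).trans (h.dist_floor_dist_le hv hw)

theorem pairwise_two_le_dist (h : IsRadialNet o V) {W : Set X} (hWV : W ⊆ V)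
    (hW : ∀ v ∈ W, ∀ w ∈ W, Even ⌊dist o v⌋₊ ↔ Even ⌊dist o w⌋₊) :
    W.Pairwise fun v w => 2 ≤ dist v w := by
  intro v hv w hw hne
  by_cases heq : dist o v = dist o w
  · exact h.two_le_dist v (hWV hv) w (hWV hw) hne heq
  · have hfloor : ⌊dist o v⌋₊ ≠ ⌊dist o w⌋₊ := fun hfloor => heq <| by
      rw [← h.natCast_floor_dist (hWV hv), hfloor, h.natCast_floor_dist (hWV hw)]
    refine le_trans ?_ (h.dist_floor_dist_le (hWV hv) (hWV hw))
    have hparity := hW v hv w hw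
    rw [Nat.even_iff, Nat.even_iff] at hparity
    rw [Nat.dist_eq]
    exact_mod_cast (by grind : (2 : ℤ) ≤ |(⌊dist o v⌋₊ : ℤ) - ⌊dist o w⌋₊|)

theorem exists_dist_le_three (h : IsRadialNet o V) (hX : IsStrictlyIntrinsic X) (x : X) {n : ℕ}
    (hn : n ≤ dist o x) (hn' : dist o x ≤ n + 1) : ∃ v ∈ V, dist o v = n ∧ dist x v ≤ 3 := by
  obtain ⟨z, hoz, hzx⟩ := hX.exists_dist_eq o x n.cast_nonneg hn
  obtain ⟨v, hv, hov, hzv⟩ := h.exists_dist_le_two z n hoz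
  exact ⟨v, hv, hov, by linarith [dist_triangle_left x v z]⟩

theorem exists_dist_lt_four (h : IsRadialNet o V) (hX : IsStrictlyIntrinsic X) (x : X) :
    ∃ v ∈ V, dist x v < 4 := by
  obtain ⟨v, hv, -, hxv⟩ := h.exists_dist_le_three hX x (Nat.floor_le dist_nonneg)
    (Nat.lt_floor_add_one _).le
  exact ⟨v, hv, by linarith⟩

theorem exists_isRadialParentMap (h : IsRadialNet o V) (hX : IsStrictlyIntrinsic X) :
    ∃ par : V → V,
      IsRadialParentMap (⟨o, h.root_mem⟩ : V) (fun v : V => ⌊dist o (v : X)⌋₊) par 3 := by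
  have hlev (v : V) : (⌊dist o (v : X)⌋₊ : ℝ) = dist o (v : X) := h.natCast_floor_dist v.2
  have hpar (v : V) : ∃ w : V, dist o (w : X) = (⌊dist o (v : X)⌋₊ - 1 : ℕ) ∧ dist v w ≤ 3 := by
    obtain ⟨n, hn⟩ := h.dist_root v v.2
    rw [hn, Nat.floor_natCast]
    obtain ⟨w, hw, how, hvw⟩ := h.exists_dist_le_three hX v (n := n - 1)
      (by rw [hn]; exact_mod_cast n.sub_le 1) (by rw [hn]; norm_cast; lia)
    exact ⟨⟨w, hw⟩, how, hvw⟩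
  choose par hpar hdist using hpar
  refine ⟨par, ⟨fun v => ?_, fun v => ?_⟩, fun v => (hlev v).symm, hdist⟩
  · rw [← Nat.cast_eq_zero (R := ℝ), hlev, dist_eq_zero, eq_comm, Subtype.ext_iff]
  · rw [hpar, Nat.floor_natCast]

end IsRadialNet

end RadialNet

section Growth

theorem HasPinchedGrowth.of_comparison {A B : Type*} [MeasurableSpace A] [MeasurableSpace B]
    {d : A → A → ℝ} {d' : B → B → ℝ} {μ : Measure A} {ν : Measure B} {a b m K s K' s' : ℝ}
    (h : HasPinchedGrowth d μ a b) (ha : 0 < a) (hb : 0 < b) (hm : 0 < m) (hK : 0 < K)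
    (hK' : 0 < K') (hs' : 0 ≤ s') (f : B → A)
    (hunit : ∀ x, ENNReal.ofReal m ≤ ν {y | d' x y < 1})
    (hlower : ∀ x r, 1 ≤ r →
      μ {y | d (f x) y < r} ≤ ENNReal.ofReal K * ν {y | d' x y < r + s})
    (hupper : ∀ x r, 1 ≤ r →
      ν {y | d' x y < r} ≤ ENNReal.ofReal K' * μ {y | d (f x) y < r + s'}) :
    HasPinchedGrowth d' ν a b := by
  obtain ⟨c, C, hc, hC, hcC⟩ := h
  refine ⟨min (c * a ^ (-s) / K) (m / max a 1 ^ (1 + s)), K' * (C * b ^ s'), by positivity,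
    by positivity, fun x r hr => ⟨?_, ?_⟩⟩
  · rcases le_or_gt (1 + s) r with hrs | hrs
    · calc ENNReal.ofReal (min (c * a ^ (-s) / K) (m / max a 1 ^ (1 + s)) * a ^ r)
        _ ≤ ENNReal.ofReal (c * a ^ (-s) / K * a ^ r) := by gcongr; exact min_le_left _ _
        _ = ENNReal.ofReal (c * a ^ (r - s)) / ENNReal.ofReal K := by
          rw [← ENNReal.ofReal_div_of_pos hK, sub_eq_neg_add, Real.rpow_add ha]
          ring_nf
        _ ≤ ν {y | d' x y < r} := ENNReal.div_le_of_le_mul' <| by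
          simpa using (hcC (f x) (r - s) (by linarith)).1.trans (hlower x (r - s) (by linarith))
    · calc ENNReal.ofReal (min (c * a ^ (-s) / K) (m / max a 1 ^ (1 + s)) * a ^ r)
        _ ≤ ENNReal.ofReal (m / max a 1 ^ (1 + s) * max a 1 ^ (1 + s)) := by
          gcongr
          · exact min_le_right _ _
          · exact (Real.rpow_le_rpow ha.le (le_max_left a 1) (by linarith)).trans
              (Real.rpow_le_rpow_of_exponent_le (le_max_right a 1) hrs.le)
        _ = ENNReal.ofReal m := by rw [div_mul_cancel₀ _ (by positivity)]
        _ ≤ ν {y | d' x y < r} := (hunit x).trans (measure_mono fun y hy => hy.trans_le hr)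
  · calc ν {y | d' x y < r}
      _ ≤ ENNReal.ofReal K' * ENNReal.ofReal (C * b ^ (r + s')) := by
        grw [hupper x r hr, (hcC (f x) (r + s') (by linarith)).2]
      _ = ENNReal.ofReal (K' * (C * b ^ s') * b ^ r) := by
        rw [← ENNReal.ofReal_mul hK'.le, Real.rpow_add hb]
        ring_nf

variable {X : Type*} [MeasurableSpace X] {μ : Measure X} {m M : ℝ≥0∞} {r ρ a b : ℝ}

section PseudoMetricSpace

variable [PseudoMetricSpace X] {V : Set X}

theorem encard_mul_le_measure_thickening [OpensMeasurableSpace X]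
    (hV : V.Pairwise fun x y => 2 * ρ ≤ dist x y) (hm : ∀ v, m ≤ μ (Metric.ball v ρ)) :
    V.encard * m ≤ μ (Metric.thickening ρ V) := by
  have hdisj : Pairwise (Function.onFun Disjoint fun v : V => Metric.ball (v : X) ρ) :=
    fun v w hvw => Metric.ball_disjoint_ball <|
      two_mul ρ ▸ hV v.2 w.2 (Subtype.coe_injective.ne hvw)
  calc V.encard * m
    _ = ∑' _ : V, m := by rw [ENNReal.tsum_const, ENat.card_coe_set_eq]
    _ ≤ ∑' v : V, μ (Metric.ball (v : X) ρ) := ENNReal.tsum_le_tsum fun v => hm v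
    _ ≤ μ (⋃ v : V, Metric.ball (v : X) ρ) :=
      tsum_meas_le_meas_iUnion_of_disjoint μ (fun _ => measurableSet_ball) hdisj
    _ = μ (Metric.thickening ρ V) := by
      rw [Metric.thickening_eq_biUnion_ball, Set.biUnion_eq_iUnion]

theorem measure_ball_le_encard_mul (hV : ∀ x, ∃ v ∈ V, dist x v < ρ)
    (hM : ∀ v, μ (Metric.ball v ρ) ≤ M) {x : X} (hfin : (V ∩ Metric.ball x (r + ρ)).Finite) :
    μ (Metric.ball x r) ≤ (V ∩ Metric.ball x (r + ρ)).encard * M := by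
  have hcover : Metric.ball x r ⊆ ⋃ v ∈ V ∩ Metric.ball x (r + ρ), Metric.ball v ρ := by
    intro y hy
    obtain ⟨v, hv, hyv⟩ := hV y
    refine Set.mem_biUnion ⟨hv, ?_⟩ hyv
    rw [Metric.mem_ball] at hy ⊢
    linarith [dist_triangle_left v x y]
  calc μ (Metric.ball x r)
    _ ≤ ∑' v : ↑(V ∩ Metric.ball x (r + ρ)), μ (Metric.ball (v : X) ρ) :=
      (measure_mono hcover).trans (measure_biUnion_le μ hfin.countable _)
    _ ≤ ∑' _ : ↑(V ∩ Metric.ball x (r + ρ)), M := ENNReal.tsum_le_tsum fun v => hM v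
    _ = (V ∩ Metric.ball x (r + ρ)).encard * M := by
      rw [ENNReal.tsum_const, ENat.card_coe_set_eq]

theorem setOf_dist_lt_eq_ball {X : Type*} [PseudoMetricSpace X] (x : X) (r : ℝ) :
    {y | dist x y < r} = Metric.ball x r := by
  ext y
  exact Metric.mem_ball'.symm

theorem HasPinchedGrowth.measure_ball_lt_top (h : HasPinchedGrowth (A := X) dist μ a b) (x : X)
    (r : ℝ) : μ (Metric.ball x r) < ∞ := by
  obtain ⟨c, C, -, -, hcC⟩ := h
  calc μ (Metric.ball x r)
    _ ≤ μ {y | dist x y < max 1 r} := by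
      rw [setOf_dist_lt_eq_ball]
      exact measure_mono (Metric.ball_subset_ball (le_max_right 1 r))
    _ < ∞ := (hcC x _ (le_max_left 1 r)).2.trans_lt ENNReal.ofReal_lt_top

end PseudoMetricSpace

section MetricSpace
variable [MetricSpace X] {o : X} {V : Set X}

theorem IsRadialNet.encard_mul_le_two_mul_measure_ball [OpensMeasurableSpace X]
    (h : IsRadialNet o V) (hm : ∀ v, m ≤ μ (Metric.ball v 1)) (x : X) (r : ℝ) :
    (V ∩ Metric.ball x r).encard * m ≤ 2 * μ (Metric.ball x (1 + r)) := by
  set S : Set X := V ∩ Metric.ball x r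
  set P : Set X := {v | Even ⌊dist o v⌋₊}
  have hparity {W : Set X} (hWS : W ⊆ S)
      (hW : ∀ v ∈ W, ∀ w ∈ W, Even ⌊dist o v⌋₊ ↔ Even ⌊dist o w⌋₊) :
      W.encard * m ≤ μ (Metric.ball x (1 + r)) := by
    have hsep : W.Pairwise fun v w => 2 * 1 ≤ dist v w := by
      simpa using h.pairwise_two_le_dist (hWS.trans Set.inter_subset_left) hW
    have hsub : Metric.thickening 1 W ⊆ Metric.ball x (1 + r) :=
      (Metric.thickening_subset_of_subset 1 (hWS.trans Set.inter_subset_right)).trans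
        (Metric.thickening_ball x 1 r)
    exact (encard_mul_le_measure_thickening hsep hm).trans (measure_mono hsub)
  calc S.encard * m
    _ = (S \ P).encard * m + (S ∩ P).encard * m := by
      rw [← Set.encard_sdiff_add_encard_inter S P, ENat.toENNReal_add, add_mul]
    _ ≤ μ (Metric.ball x (1 + r)) + μ (Metric.ball x (1 + r)) :=
      add_le_add (hparity Set.sdiff_subset fun v hv w hw => iff_of_false hv.2 hw.2)
        (hparity Set.inter_subset_left fun v hv w hw => iff_of_true hv.2 hw.2)
    _ = 2 * μ (Metric.ball x (1 + r)) := (two_mul _).symm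

theorem HasPinchedGrowth.exists_ofReal_le_measure_ball_one
    (hμ : HasPinchedGrowth (A := X) dist μ a b) (ha : 0 < a) :
    ∃ e : ℝ, 0 < e ∧ ∀ v, ENNReal.ofReal e ≤ μ (Metric.ball v 1) := by
  obtain ⟨c, C, hc, -, hcC⟩ := hμ
  exact ⟨c * a, mul_pos hc ha, fun v => by
    simpa [setOf_dist_lt_eq_ball] using (hcC v 1 le_rfl).1⟩

theorem IsRadialNet.exists_encard_le_mul_measure_ball [OpensMeasurableSpace X]
    (h : IsRadialNet o V) (hμ : HasPinchedGrowth (A := X) dist μ a b) (ha : 0 < a) :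
    ∃ K : ℝ, 0 < K ∧ ∀ x r,
      (V ∩ Metric.ball x r).encard ≤ ENNReal.ofReal K * μ (Metric.ball x (1 + r)) := by
  obtain ⟨e, he, hball⟩ := hμ.exists_ofReal_le_measure_ball_one ha
  refine ⟨2 / e, div_pos two_pos he, fun x r => ?_⟩
  rw [ENNReal.ofReal_div_of_pos he, ← ENNReal.mul_div_right_comm, ENNReal.ofReal_ofNat,
    ENNReal.le_div_iff_mul_le (.inl (by simpa using he)) (.inl ENNReal.ofReal_ne_top)]
  exact h.encard_mul_le_two_mul_measure_ball hball x r

theorem IsRadialNet.finite_inter_ball [OpensMeasurableSpace X] (h : IsRadialNet o V)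
    (hμ : HasPinchedGrowth (A := X) dist μ a b) (ha : 0 < a) (x : X) (r : ℝ) :
    (V ∩ Metric.ball x r).Finite := by
  obtain ⟨K, -, hK⟩ := h.exists_encard_le_mul_measure_ball hμ ha
  rw [← Set.encard_lt_top_iff, ← ENat.toENNReal_lt_top]
  exact (hK x r).trans_lt (ENNReal.mul_lt_top ENNReal.ofReal_lt_top (hμ.measure_ball_lt_top x _))

theorem IsRadialNet.finite_neighborSet [OpensMeasurableSpace X] (h : IsRadialNet o V)
    (hμ : HasPinchedGrowth (A := X) dist μ a b) (ha : 0 < a) {G : SimpleGraph V} {R : ℝ}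
    (hG : ∀ v w, G.Adj v w → dist v w ≤ R) (v : V) : (G.neighborSet v).Finite := by
  have hfin : {w : V | ↑w ∈ V ∩ Metric.ball (v : X) (R + 1)}.Finite :=
    (h.finite_inter_ball hμ ha v (R + 1)).preimage Subtype.coe_injective.injOn
  exact hfin.subset fun w hw =>
    ⟨w.2, Metric.mem_ball'.2 ((hG v w hw).trans_lt (lt_add_one R))⟩

theorem IsRadialNet.exists_measure_ball_le_mul_encard [OpensMeasurableSpace X]
    (h : IsRadialNet o V) (hX : IsStrictlyIntrinsic X)
    (hμ : HasPinchedGrowth (A := X) dist μ a b) (ha : 0 < a) (hb : 0 < b) :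
    ∃ K : ℝ, 0 < K ∧ ∀ x r,
      μ (Metric.ball x r) ≤ ENNReal.ofReal K * (V ∩ Metric.ball x (r + 4)).encard := by
  obtain ⟨_, C, -, hC, hcC⟩ := id hμ
  refine ⟨C * b ^ (4 : ℝ), mul_pos hC (Real.rpow_pos_of_pos hb 4), fun x r => ?_⟩
  rw [mul_comm]
  exact measure_ball_le_encard_mul (h.exists_dist_lt_four hX)
    (fun v => setOf_dist_lt_eq_ball v 4 ▸ (hcC v 4 (by norm_num)).2)
    (h.finite_inter_ball hμ ha x _)

theorem count_preimage_coe {X : Type*} (V U : Set X) :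
    @Measure.count V ⊤ ((↑) ⁻¹' U) = ((V ∩ U).encard : ℝ≥0∞) := by
  rw [@Measure.count_apply _ ⊤ _ trivial, ← Subtype.image_preimage_coe,
    Subtype.val_injective.encard_image]

theorem IsRadialNet.hasPinchedGrowth_count [OpensMeasurableSpace X] (h : IsRadialNet o V)
    (hX : IsStrictlyIntrinsic X) (hμ : HasPinchedGrowth (A := X) dist μ a b) (ha : 0 < a)
    (hb : 0 < b) {d' : V → V → ℝ} {β : ℝ} (hd : ∀ v w, |d' v w - dist v w| ≤ β)
    (hself : ∀ v, d' v v = 0) : @HasPinchedGrowth V ⊤ d' (@Measure.count V ⊤) a b := by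
  let _ : MeasurableSpace V := ⊤
  obtain ⟨K, hK, hmeasure⟩ := h.exists_measure_ball_le_mul_encard hX hμ ha hb
  obtain ⟨K', hK', hencard⟩ := h.exists_encard_le_mul_measure_ball hμ ha
  have hβ : 0 ≤ β := (abs_nonneg _).trans (hd ⟨o, h.root_mem⟩ ⟨o, h.root_mem⟩)
  refine hμ.of_comparison (s := 4 + β) (s' := 1 + β) ha hb one_pos hK hK' (by positivity) (↑)
    (fun v => ?_) (fun v r _ => ?_) fun v r _ => ?_
  · calc ENNReal.ofReal 1
      _ = Measure.count {v} := by simp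
      _ ≤ Measure.count {w | d' v w < 1} := measure_mono fun w hw => by
        obtain rfl : w = v := hw
        exact (hself w).trans_lt one_pos
  · rw [setOf_dist_lt_eq_ball]
    grw [hmeasure, ← count_preimage_coe]
    gcongr
    intro w hw
    have hvw : dist v w < r + 4 := Metric.mem_ball'.1 hw
    have : d' v w < r + (4 + β) := by linarith [(abs_le.1 (hd v w)).2]
    exact this
  · calc Measure.count {w | d' v w < r}
      _ ≤ Measure.count ((↑) ⁻¹' Metric.ball (v : X) (r + β)) := measure_mono fun w hw => by
        have hvw : d' v w < r := hw
        have : dist v w < r + β := by linarith [(abs_le.1 (hd v w)).1]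
        exact Metric.mem_ball'.2 this
      _ ≤ ENNReal.ofReal K' * μ {y | dist (v : X) y < r + (1 + β)} := by
        rw [setOf_dist_lt_eq_ball, count_preimage_coe, add_left_comm]
        exact hencard v _

end MetricSpace

end Growth

theorem IsRoughIsometry.of_abs_sub_le {A B : Type*} {d : A → A → ℝ} {d' : B → B → ℝ} {β M : ℝ}
    {f : A → B} (hβ : 0 ≤ β) (h : ∀ x y, |d x y - d' (f x) (f y)| ≤ β)
    (hM : ∀ z, ∃ x, d' (f x) z ≤ M) : IsRoughIsometry d d' 1 β f where
  one_le := le_rfl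
  nonneg := hβ
  lower x y := by linarith [(abs_le.1 (h x y)).2]
  upper x y := by linarith [(abs_le.1 (h x y)).1]
  cobounded := ⟨M, hM⟩

end SpidersWeb

open SpidersWeb in
theorem theorem5p1_general {X : Type*} [MetricSpace X] [MeasurableSpace X] [OpensMeasurableSpace X]
    [Nonempty X] (μ : Measure X) (δ a b : ℝ) (ha : 0 < a) (hb : 0 < b)
    (hX : IsStrictlyIntrinsic X) (hyp : IsHyperbolic (fun x y : X => dist x y) δ)
    (hμ : HasPinchedGrowth (fun x y : X => dist x y) μ a b) :
    ∃ δ' : ℝ, 0 < δ' ∧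
      ∃ V : Set X, IsClosed V ∧ DiscreteTopology V ∧
        ∃ (T : SimpleGraph V) (o : V) (G : SimpleGraph V),
          MemClassUpsilon δ' a b T o G ∧
          ∃ β : ℝ, IsRoughIsometry (graphDist G) (fun x y : X => dist x y) 1 β
            (fun v : V => (v : X)) := by
  obtain ⟨o⟩ := ‹Nonempty X›
  obtain ⟨V, hV⟩ := exists_isRadialNet o
  obtain ⟨par, hpar⟩ := hV.exists_isRadialParentMap hX
  have hsep := hV.pairwise_one_le_dist
  have hypV : IsHyperbolic (A := V) dist δ := fun x y z w => hyp x y z w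
  have hdist := hpar.abs_graphDist_sub_dist_le hypV
  have hβ : 3 ≤ webDefect δ 3 := three_le_webDefect hyp.nonneg hpar.nonneg
  have hweb := hpar.isSpidersWeb <|
    hV.finite_neighborSet hμ ha fun v w => hpar.dist_le_of_parentWeb_adj hypV
  have hgrowth := hV.hasPinchedGrowth_count hX hμ ha hb hdist fun v => by simp [graphDist]
  have hisom : IsRoughIsometry _ (fun x y : X => dist x y) 1 (webDefect δ 3) ((↑) : V → X) :=
    .of_abs_sub_le (M := 4) (by linarith) hdist fun z => by
      obtain ⟨v, hv, hzv⟩ := hV.exists_dist_lt_four hX z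
      exact ⟨⟨v, hv⟩, dist_comm z v ▸ hzv.le⟩
  exact ⟨δ + 3 * webDefect δ 3, by linarith [hyp.nonneg], V,
    Metric.isClosed_of_pairwise_le_dist one_pos hsep,
    .of_forall_le_dist one_pos fun v w hvw =>
      hsep v.2 w.2 (Subtype.coe_injective.ne hvw),
    _, _, _, ⟨hweb, hypV.of_abs_sub_le hdist, hgrowth⟩, _, hisom⟩

theorem theorem5p1 {X : Type*} [MetricSpace X] [MeasurableSpace X] [BorelSpace X]
    (μ : Measure X) (δ a b : ℝ) (hδ : 0 ≤ δ) (ha : 1 < a) (hab : a ≤ b)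
    (hX : SpidersWeb.MemClassX δ a b X μ) :
    ∃ δ' : ℝ, 0 < δ' ∧
      ∃ V : Set X, IsClosed V ∧ DiscreteTopology V ∧
        ∃ (T : SimpleGraph V) (o : V) (G : SimpleGraph V),
          SpidersWeb.MemClassUpsilon δ' a b T o G ∧
          ∃ β : ℝ, SpidersWeb.IsRoughIsometry (SpidersWeb.graphDist G)
            (fun x y : X => dist x y) 1 β (fun v : V => (v : X)) := by
  have := hX.connected
  exact theorem5p1_general μ δ a b (by linarith) (by linarith) hX.strictlyIntrinsic hX.hyperbolic
    hX.growth
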